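/- Let $\mu=(\mu_k)_{k\ge 0}$ be a probability distribution on $\{0,1,2,\dots\}$ with $\mu_0+\mu_1<1$, and let $G(t)=\sum_{k\ge 0}\mu_k t^k$, with $G'$ and $G''$ given by the termwise differentiated series. Consider finite connected subsets $\mathbf t$, containing the root, of the infinite rooted binary tree in which every vertex has a left and a right child, decorated with numbers $a_u\in\{0,1,2,\dots\}$ of cars arriving at the vertices $u\in\mathbf t$. Each vertex can hold one car; a car that finds its vertex occupied drives towards the root, parks at the first free vertex, and leaves the tree if there is none. Thus the number of cars visiting $u$ is $x(u)=a_u+\sum_{v}(x(v)-1)_+$, the sum being over the children $v$ of $u$ in $\mathbf t$. The tree is fully parked if $x(u)\ge 1$ for all $u\in\mathbf t$, and its flux is then $x(\text{root})-1$. Let $\mathbb T_n^{(p)}$ be the set of fully parked trees with $n$ vertices and flux $p$, let $w(\mathbf t)=\prod_{u\in\mathbf t}\mu_{a_u}$, and set $$F(x,y)=\sum_{n\ge 1}\sum_{p\ge 0}\sum_{\mathbf t\in\mathbb T_n^{(p)}}x^n y^p\,w(\mathbf t),\qquad \mathbf F_0(x)=1+F(x,0).$$ Suppose that there is $t_c\in(0,\infty)$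 with $$t_c=\min\{t\ge 0:\ 2(G(t)-tG'(t))^2=t^2G(t)G''(t)\},\qquad(\star)$$ where only those $t$ are considered at which the series $G$, $G'$ and $G''$ converge. Put $$\psi(y)=\frac{y\,(2G(y)-yG'(y))}{4G(y)^2},\qquad x_c=\psi(t_c).$$ Then $x_c>0$, $$\lim_{x\uparrow x_c}\mathbf F_0''(x)=+\infty,$$ the radius of convergence of the power series $\mathbf F_0$ is equal to $x_c$, and this series converges at $x_c$, with $$\mathbf F_0(x_c)=\frac{2\,G(t_c)\sqrt{G(t_c)-t_cG'(t_c)}}{(2G(t_c)-t_cG'(t_c))\sqrt{G(0)}}.$$ -/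

import Mathlib

open Filter Topology
open scoped PowerSeries

noncomputable section

namespace Parking

/-! ### Real power series -/

/-- The sum at `x` of a real power series (meaningful where the series converges). -/
def psSum (f : ℝ⟦X⟧) (x : ℝ) : ℝ := ∑' n : ℕ, PowerSeries.coeff n f * x ^ n

/-- Convergence at `x` of a real power series. -/
def PSConv (f : ℝ⟦X⟧) (x : ℝ) : Prop := Summable fun n : ℕ => PowerSeries.coeff n f * x ^ n

/-- The radius of convergence, in `[0, ∞]`, of a real power series. -/
def psRadius (f : ℝ⟦X⟧) : ENNReal :=
  (FormalMultilinearSeries.ofScalars ℝ fun n : ℕ => PowerSeries.coeff n f).radius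

/-! ### The generating function of the car arrivals -/

/-- The generating series `G = ∑ μ_k X^k` of the law `μ` of the car arrivals. -/
def arrivalSeries (μ : PMF ℕ) : ℝ⟦X⟧ := PowerSeries.mk fun k => (μ k).toReal

/-- `G(t) = ∑ μ_k t^k`. -/
def G (μ : PMF ℕ) (t : ℝ) : ℝ := psSum (arrivalSeries μ) t

/-- `G'(t) = ∑ k μ_k t^(k-1)`. The series is used because `t` may be equal to the radius of
convergence of `G`. -/
def G' (μ : PMF ℕ) (t : ℝ) : ℝ := psSum (PowerSeries.derivative ℝ (arrivalSeries μ)) t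

/-- `G''(t) = ∑ k (k-1) μ_k t^(k-2)`. -/
def G'' (μ : PMF ℕ) (t : ℝ) : ℝ :=
  psSum (PowerSeries.derivative ℝ (PowerSeries.derivative ℝ (arrivalSeries μ))) t

/-- The set of all `t ≥ 0` at which `G`, `G'`, `G''` are defined (their series converge) and
`2 (G(t) - t G'(t))² = t² G(t) G''(t)`. -/
def starSet (μ : PMF ℕ) : Set ℝ :=
  {t | 0 ≤ t ∧
    PSConv (arrivalSeries μ) t ∧
    PSConv (PowerSeries.derivative ℝ (arrivalSeries μ)) t ∧
    PSConv (PowerSeries.derivative ℝ (PowerSeries.derivative ℝ (arrivalSeries μ))) t ∧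
    2 * (G μ t - t * G' μ t) ^ 2 = t ^ 2 * G μ t * G'' μ t}

/-- Condition `(⋆)`: the set above has a minimum, which is `tc`, and `tc ∈ (0, ∞)`. -/
def Star (μ : PMF ℕ) (tc : ℝ) : Prop := 0 < tc ∧ IsLeast (starSet μ) tc

/-- The function `ψ(y) = y (2 G(y) - y G'(y)) / (4 G(y)²)`. -/
def psi (μ : PMF ℕ) (y : ℝ) : ℝ := y * (2 * G μ y - y * G' μ y) / (4 * G μ y ^ 2)

/-! ### Fully parked trees

A finite connected subset of the infinite binary tree that contains the root, decorated with car
arrivals `a_u ∈ ℕ` at its vertices, is a nonempty `BinaryTree ℕ`: `node a l r` has `a` cars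
arriving at its root, and `l`, `r` are the parts above the left and the right child of the root
(`nil` if that child does not belong to the subset). -/

/-- The number of cars that visit the root when the cars of the decorated tree park: those that
arrive there and the outgoing fluxes `(x - 1)₊` of its children. -/
def visits : BinaryTree ℕ → ℕ
  | .nil => 0
  | .node a l r => a + (visits l - 1) + (visits r - 1)

/-- All vertices of the tree are occupied after parking: each is visited by at least one car. -/
def AllParked : BinaryTree ℕ → Prop
  | .nil => True
  | .node a l r => 1 ≤ visits (.node a l r) ∧ AllParked l ∧ AllParked r

/-- The fully parked trees with `n` vertices and outgoing flux `p`, that is, with `p + 1` cars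
visiting the root. (The empty tree has no visiting car, so it does not belong to this set.) -/
def fullyParkedTrees (n p : ℕ) : Set (BinaryTree ℕ) :=
  {t | AllParked t ∧ t.numNodes = n ∧ visits t = p + 1}

/-- The weight `∏ μ_{a_u}` of a decorated tree. -/
def weight (μ : PMF ℕ) : BinaryTree ℕ → ℝ
  | .nil => 1
  | .node a l r => (μ a).toReal * weight μ l * weight μ r

/-- The total number of cars. -/
def cars : BinaryTree ℕ → ℕ
  | .nil => 0
  | .node a l r => a + cars l + cars r

theorem cars_le : ∀ t : BinaryTree ℕ, AllParked t → cars t ≤ visits t - 1 + t.numNodes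
  | .nil, _ => by simp [cars]
  | .node a l r, h => by
    obtain ⟨h0, hl, hr⟩ := h
    have h1 := cars_le l hl
    have h2 := cars_le r hr
    simp only [visits] at h0
    simp only [cars, visits, BinaryTree.numNodes]
    omega

theorem finite_bounded (n m : ℕ) : {t : BinaryTree ℕ | t.numNodes ≤ n ∧ cars t ≤ m}.Finite := by
  induction n with
  | zero =>
    refine (Set.finite_singleton BinaryTree.nil).subset ?_
    rintro (_ | ⟨a, l, r⟩) ⟨h, -⟩
    · rfl
    · simp at h
  | succ n ih =>
    refine ((Set.finite_singleton BinaryTree.nil).union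
      (((Set.finite_Iic m).prod (ih.prod ih)).image
        fun q : ℕ × BinaryTree ℕ × BinaryTree ℕ => BinaryTree.node q.1 q.2.1 q.2.2)).subset ?_
    rintro (_ | ⟨a, l, r⟩) ⟨h, h'⟩
    · exact Or.inl rfl
    · right
      simp only [BinaryTree.numNodes] at h
      simp only [cars] at h'
      refine ⟨(a, l, r), ⟨?_, ⟨?_, ?_⟩, ⟨?_, ?_⟩⟩, rfl⟩ <;>
        simp only [Set.mem_Iic] <;> omega

theorem finite_fullyParkedTrees (n p : ℕ) : (fullyParkedTrees n p).Finite := by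
  refine (finite_bounded n (p + 1 + n)).subset ?_
  rintro t ⟨h1, h2, h3⟩
  have := cars_le t h1
  exact ⟨h2.le, by omega⟩

/-- The bivariate generating series `F(x, y) = ∑_n ∑_p ∑_t x^n y^p w(t)`, where `t` runs over the
fully parked trees with `n` vertices and flux `p`, as a power series in `x` whose coefficients are
power series in `y`. -/
def fptSeries (μ : PMF ℕ) : ℝ⟦X⟧⟦X⟧ :=
  PowerSeries.mk fun n => PowerSeries.mk fun p =>
    ∑ t ∈ (finite_fullyParkedTrees n p).toFinset, weight μ t

/-- `𝐅₀(x) = 1 + F(x, 0)`. -/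
def F₀ (μ : PMF ℕ) : ℝ⟦X⟧ :=
  1 + PowerSeries.map (PowerSeries.constantCoeff (R := ℝ)) (fptSeries μ)

end Parking

end

namespace Parking

/-! ### Real power series with nonnegative coefficients -/

/-! Fix a small `x > 0` and put Z(y) = 1 + F(x, y). Cutting a tree at its root gives y(Z(y) - 1) = x
G(y) Z(y)² - x G(0) 𝐅₀(x)² (`functional_equation`), so the discriminant y² - 4xyG(y) +
4x²G(0)𝐅₀(x)²G(y) equals A(y)² with A(y) = y - 2xG(y)Z(y). The continuous function A changes sign on
(0, t_c), hence the discriminant has a double zero there (`Star.exists_double_root`). Its vanishing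
together with that of its derivative gives x = ψ(y) and 𝐅₀(x) = Φ(y), where Φ is `Phi`
(`Star.exists_psi_eq`).

The numerator of ψ' is the gap between the two sides of (⋆), so ψ increases on [0, t_c] and ψ'
vanishes at t_c. Thus Φ ∘ ψ⁻¹ is analytic on (0, x_c) and agrees with 𝐅₀ near 0. Since 𝐅₀ has
nonnegative coefficients, a Pringsheim argument (`exists_psConv_of_analyticAt`) excludes a radius
below x_c, and the agreement extends to (0, x_c).

The derivative of Φ contains the factor ψ', so 𝐅₀' = Φ'/ψ' has a finite expression in y up to t_c.
Its y-derivative has a positive limit at t_c, and one more division by ψ' → 0+ makes 𝐅₀'' tend to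
+∞. This also bounds the radius above by x_c. Convergence and the value at x_c follow from Φ(y) →
Φ(t_c) by monotonicity. -/

theorem PSConv.mono {f : ℝ⟦X⟧} (hf : ∀ n, 0 ≤ PowerSeries.coeff n f) {s t : ℝ} (hs : 0 ≤ s)
    (hst : s ≤ t) (h : PSConv f t) : PSConv f s :=
  Summable.of_nonneg_of_le (fun n => mul_nonneg (hf n) (pow_nonneg hs n))
    (fun n => mul_le_mul_of_nonneg_left (pow_le_pow_left₀ hs hst n) (hf n)) h

theorem psSum_nonneg {f : ℝ⟦X⟧} (hf : ∀ n, 0 ≤ PowerSeries.coeff n f) {x : ℝ} (hx : 0 ≤ x) :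
    0 ≤ psSum f x :=
  tsum_nonneg fun n => mul_nonneg (hf n) (pow_nonneg hx n)

theorem le_psSum {f : ℝ⟦X⟧} (hf : ∀ n, 0 ≤ PowerSeries.coeff n f) {x : ℝ} (hx : 0 ≤ x)
    (h : PSConv f x) (n : ℕ) : PowerSeries.coeff n f * x ^ n ≤ psSum f x :=
  h.le_tsum n fun m _ => mul_nonneg (hf m) (pow_nonneg hx m)

theorem psSum_zero (f : ℝ⟦X⟧) : psSum f 0 = PowerSeries.coeff 0 f := by
  rw [psSum, tsum_eq_single 0 fun n hn => by simp [hn]]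
  simp

theorem psSum_eq_sum (f : ℝ⟦X⟧) :
    psSum f = (FormalMultilinearSeries.ofScalars ℝ fun n : ℕ => PowerSeries.coeff n f).sum := by
  funext x
  simp [psSum, FormalMultilinearSeries.sum, mul_comm]

theorem le_psRadius {f : ℝ⟦X⟧} {t : ℝ} (ht : 0 ≤ t) (h : PSConv f t) :
    ENNReal.ofReal t ≤ psRadius f := by
  refine FormalMultilinearSeries.le_radius_of_summable (r := t.toNNReal) _ ?_
  refine h.norm.congr fun n => ?_
  simp [abs_of_nonneg ht, ht]

theorem hasFPowerSeriesOnBall_psSum {f : ℝ⟦X⟧} (h : 0 < psRadius f) :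
    HasFPowerSeriesOnBall (psSum f)
      (FormalMultilinearSeries.ofScalars ℝ fun n : ℕ => PowerSeries.coeff n f) 0 (psRadius f) := by
  rw [psSum_eq_sum]
  exact FormalMultilinearSeries.hasFPowerSeriesOnBall _ h

theorem analyticAt_psSum_of_lt_psRadius {f : ℝ⟦X⟧} {x : ℝ} (hx : 0 ≤ x)
    (h : ENNReal.ofReal x < psRadius f) : AnalyticAt ℝ (psSum f) x := by
  refine (hasFPowerSeriesOnBall_psSum (bot_le.trans_lt h)).analyticAt_of_mem ?_
  rw [Metric.mem_eball, edist_dist, Real.dist_eq, sub_zero, abs_of_nonneg hx]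
  exact h

theorem PSConv.analyticAt {f : ℝ⟦X⟧} {x t : ℝ} (hx : 0 ≤ x) (hxt : x < t) (h : PSConv f t) :
    AnalyticAt ℝ (psSum f) x :=
  analyticAt_psSum_of_lt_psRadius hx <|
    ((ENNReal.ofReal_lt_ofReal_iff (hx.trans_lt hxt)).2 hxt).trans_le
      (le_psRadius (hx.trans hxt.le) h)

/-- The terms at `t` dominate, so the endpoint is included; this matters because `t_c` may be the
radius of convergence of `G`. -/
theorem PSConv.continuousOn {f : ℝ⟦X⟧} (hf : ∀ n, 0 ≤ PowerSeries.coeff n f) {t : ℝ}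
    (h : PSConv f t) : ContinuousOn (psSum f) (Set.Icc 0 t) := by
  refine continuousOn_tsum (fun n => by fun_prop) h fun n x hx => ?_
  rw [Real.norm_eq_abs, abs_of_nonneg (mul_nonneg (hf n) (pow_nonneg hx.1 n))]
  exact mul_le_mul_of_nonneg_left (pow_le_pow_left₀ hx.1 hx.2 n) (hf n)

theorem coeff_derivative_nonneg {f : ℝ⟦X⟧} (hf : ∀ n, 0 ≤ PowerSeries.coeff n f) (n : ℕ) :
    0 ≤ PowerSeries.coeff n (PowerSeries.derivative ℝ f) := by
  rw [PowerSeries.coeff_derivative]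
  exact mul_nonneg (hf _) (by positivity)

theorem PSConv.derivative {f : ℝ⟦X⟧} (hf : ∀ n, 0 ≤ PowerSeries.coeff n f) {s t : ℝ} (hs : 0 ≤ s)
    (hst : s < t) (h : PSConv f t) : PSConv (PowerSeries.derivative ℝ f) s := by
  have ht : 0 < t := hs.trans_lt hst
  have hq : Tendsto (fun n : ℕ => (n : ℝ) * (s / t) ^ n) atTop (𝓝 0) :=
    tendsto_self_mul_const_pow_of_lt_one (div_nonneg hs ht.le) ((div_lt_one ht).2 hst)
  have hq' : Tendsto (fun n : ℕ => (s / t) ^ n) atTop (𝓝 0) :=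
    tendsto_pow_atTop_nhds_zero_of_lt_one (div_nonneg hs ht.le) ((div_lt_one ht).2 hst)
  obtain ⟨C, hC⟩ := (hq.add hq').bddAbove_range
  have h1 : Summable fun n : ℕ =>
      C / t * (PowerSeries.coeff (n + 1) f * t ^ (n + 1)) :=
    ((summable_nat_add_iff 1).2 h).mul_left _
  refine Summable.of_nonneg_of_le
    (fun n => mul_nonneg (coeff_derivative_nonneg hf n) (pow_nonneg hs n)) (fun n => ?_) h1
  have h2 : (n : ℝ) * (s / t) ^ n + (s / t) ^ n ≤ C := hC ⟨n, rfl⟩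
  have h3 : ((n : ℝ) + 1) * s ^ n ≤ C * t ^ n := by
    rw [div_pow, ← add_one_mul, ← mul_div_assoc, div_le_iff₀ (pow_pos ht n)] at h2
    exact h2
  rw [PowerSeries.coeff_derivative]
  have h4 : C / t * (PowerSeries.coeff (n + 1) f * t ^ (n + 1)) =
      PowerSeries.coeff (n + 1) f * (C * t ^ n) := by
    field_simp
    ring
  rw [h4, mul_assoc]
  exact mul_le_mul_of_nonneg_left h3 (hf _)

theorem hasDerivAt_psSum {f : ℝ⟦X⟧} (hf : ∀ n, 0 ≤ PowerSeries.coeff n f) {x t : ℝ} (hx : 0 < x)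
    (hxt : x < t) (h : PSConv f t) :
    HasDerivAt (psSum f) (psSum (PowerSeries.derivative ℝ f) x) x := by
  obtain ⟨s, hxs, hst⟩ := exists_between hxt
  have hd := h.derivative hf (hx.trans hxs).le hst
  have hu : Summable fun n : ℕ => PowerSeries.coeff n f * (n * s ^ (n - 1)) := by
    refine (summable_nat_add_iff 1).1 (hd.congr fun n => ?_)
    rw [PowerSeries.coeff_derivative]
    push_cast [Nat.add_sub_cancel]
    ring
  have key := hasDerivAt_tsum_of_isPreconnected (t := Set.Ioo 0 s)
    (g := fun n y => PowerSeries.coeff n f * y ^ n)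
    (g' := fun n y => PowerSeries.coeff n f * (n * y ^ (n - 1))) hu isOpen_Ioo
    isPreconnected_Ioo (fun n y _ => (hasDerivAt_pow n y).const_mul _) (fun n y hy => ?_)
    (y₀ := x) ⟨hx, hxs⟩ (h.mono hf hx.le hxt.le) (y := x) ⟨hx, hxs⟩
  · refine key.congr_deriv ?_
    have hsx : Summable fun n : ℕ => PowerSeries.coeff n f * (n * x ^ (n - 1)) := by
      refine (summable_nat_add_iff 1).1 ((hd.mono (coeff_derivative_nonneg hf) hx.le hxs.le).congr
        fun n => ?_)
      rw [PowerSeries.coeff_derivative]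
      push_cast [Nat.add_sub_cancel]
      ring
    rw [hsx.tsum_eq_zero_add, psSum]
    simp only [CharP.cast_eq_zero, zero_mul, mul_zero, zero_add, PowerSeries.coeff_derivative]
    refine tsum_congr fun n => ?_
    push_cast [Nat.add_sub_cancel]
    ring
  · have h1 : 0 ≤ PowerSeries.coeff n f * (n * y ^ (n - 1)) :=
      mul_nonneg (hf n) (mul_nonneg n.cast_nonneg (pow_nonneg hy.1.le _))
    rw [Real.norm_eq_abs, abs_of_nonneg h1]
    gcongr
    · exact hf n
    · exact hy.1.le
    · exact hy.2.le

theorem iteratedDeriv_psSum_nonneg (k : ℕ) {t : ℝ} : ∀ {f : ℝ⟦X⟧},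
    (∀ n, 0 ≤ PowerSeries.coeff n f) → (∀ s, 0 ≤ s → s < t → PSConv f s) →
    ∀ {x : ℝ}, 0 < x → x < t → 0 ≤ iteratedDeriv k (psSum f) x := by
  induction k with
  | zero =>
    intro f hf _ x hx _
    rw [iteratedDeriv_zero]
    exact psSum_nonneg hf hx.le
  | succ k ih =>
    intro f hf hc x hx hxt
    have hE : deriv (psSum f) =ᶠ[𝓝 x] psSum (PowerSeries.derivative ℝ f) := by
      filter_upwards [Ioo_mem_nhds hx hxt] with y hy
      obtain ⟨s, hys, hst⟩ := exists_between hy.2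
      exact (hasDerivAt_psSum hf hy.1 hys (hc s (hy.1.trans hys).le hst)).deriv
    rw [iteratedDeriv_succ', (hE.iteratedDeriv_eq k)]
    refine ih (coeff_derivative_nonneg hf) (fun s hs hst => ?_) hx hxt
    obtain ⟨r, hsr, hrt⟩ := exists_between hst
    exact (hc r (hs.trans hsr.le) hrt).derivative hf hs hsr

/-- A function which is analytic at `ρ` and agrees to the left of `ρ` with a power series with
nonnegative coefficients bounds the partial sums of this series beyond `ρ`. -/
theorem exists_psConv_of_analyticAt {a : ℝ⟦X⟧} (ha : ∀ n, 0 ≤ PowerSeries.coeff n a) {ρ : ℝ}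
    (hρ : 0 < ρ) (hc : ∀ s, 0 ≤ s → s < ρ → PSConv a s) {g : ℝ → ℝ} (hg : AnalyticAt ℝ g ρ)
    (hag : ∀ s, 0 < s → s < ρ → psSum a s = g s) : ∃ t, ρ < t ∧ PSConv a t := by
  obtain ⟨q, r, hq⟩ := hg
  obtain ⟨ε, hε, hεr⟩ := ENNReal.lt_iff_exists_nnreal_btwn.1 hq.r_pos
  have hε0 : (0 : ℝ) < ε := by exact_mod_cast hε
  replace hq := hq.mono hε hεr.le
  -- The expansion around `ρ - d` converges within `ε - d > 2 * d`, so it reaches `ρ + d`.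
  obtain ⟨d, hd0, hdε, hdρ⟩ : ∃ d : ℝ, 0 < d ∧ d < ε / 3 ∧ d < ρ :=
    ⟨min ((ε : ℝ) / 3) ρ / 2, by positivity,
      by linarith [min_le_left ((ε : ℝ) / 3) ρ, show 0 < min ((ε : ℝ) / 3) ρ by positivity],
      by linarith [min_le_right ((ε : ℝ) / 3) ρ, show 0 < min ((ε : ℝ) / 3) ρ by positivity]⟩
  refine ⟨ρ + d, by linarith, summable_of_sum_range_le (c := g (ρ + d))
    (fun n => mul_nonneg (ha n) (by positivity)) fun N => ?_⟩
  set P : FormalMultilinearSeries ℝ ℝ ℝ :=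
    FormalMultilinearSeries.ofScalars ℝ fun n : ℕ => if n < N then PowerSeries.coeff n a else 0
  have hPr : P.radius = ⊤ :=
    FormalMultilinearSeries.radius_eq_top_of_forall_image_add_eq_zero _ N fun m => by simp [P]
  have hPs : P.sum = fun x => ∑ n ∈ Finset.range N, PowerSeries.coeff n a * x ^ n := by
    funext x
    rw [FormalMultilinearSeries.sum, tsum_eq_sum (s := Finset.range N)]
    · refine Finset.sum_congr rfl fun n hn => ?_
      simp [P, Finset.mem_range.1 hn, mul_comm]
    · intro n hn
      rw [Finset.mem_range] at hn
      simp [P, hn]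
  have hPρ : HasFPowerSeriesOnBall P.sum (P.changeOrigin ρ) ρ ε := by
    have h1 := (P.hasFPowerSeriesOnBall (by simp [hPr])).changeOrigin (y := ρ) (by simp [hPr])
    rw [zero_add, hPr, ENNReal.top_sub_coe] at h1
    exact h1.mono hε le_top
  have hu := hq.sub hPρ
  have hu' := hu.changeOrigin (y := -d) (by
    rw [ENNReal.coe_lt_coe, ← NNReal.coe_lt_coe, coe_nnnorm, norm_neg, Real.norm_eq_abs,
      abs_of_pos hd0]
    linarith)
  -- By uniqueness the recentred series is the Taylor series at `ρ - d`; the signs of its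
  -- coefficients are those of the iterated derivatives.
  have hser := hu'.analyticAt.hasFPowerSeriesAt.eq_formalMultilinearSeries hu'.hasFPowerSeriesAt
  rw [← hser] at hu'
  have hmem : (2 * d : ℝ) ∈ Metric.eball (0 : ℝ) (ε - ‖-d‖₊ : ENNReal) := by
    rw [Metric.mem_eball, edist_zero_right, ← ENNReal.coe_sub, enorm_eq_nnnorm, ENNReal.coe_lt_coe,
      ← NNReal.coe_lt_coe, coe_nnnorm, NNReal.coe_sub]
    · rw [coe_nnnorm, norm_neg, Real.norm_eq_abs, Real.norm_eq_abs, abs_of_pos hd0,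
        abs_of_pos (by positivity)]
      linarith
    · rw [← NNReal.coe_le_coe, coe_nnnorm, norm_neg, Real.norm_eq_abs, abs_of_pos hd0]
      linarith
  have hsum := hu'.hasSum hmem
  have hpos : ∀ k, 0 ≤ iteratedDeriv k (g - P.sum) (ρ + -d) := by
    intro k
    -- To the left of `ρ`, `g` minus the partial sum is the tail of the series, all of whose
    -- derivatives are nonnegative.
    set b : ℝ⟦X⟧ := PowerSeries.mk fun n => if n < N then 0 else PowerSeries.coeff n a
    have hb : ∀ n, 0 ≤ PowerSeries.coeff n b := by
      intro n
      simp only [b, PowerSeries.coeff_mk]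
      split_ifs
      exacts [le_rfl, ha n]
    have hbc : ∀ s, 0 ≤ s → s < ρ → PSConv b s := by
      intro s hs hsρ
      refine Summable.of_nonneg_of_le (fun n => mul_nonneg (hb n) (pow_nonneg hs n)) (fun n => ?_)
        (hc s hs hsρ)
      refine mul_le_mul_of_nonneg_right ?_ (pow_nonneg hs n)
      simp only [b, PowerSeries.coeff_mk]
      split_ifs
      exacts [ha n, le_rfl]
    have hE : g - P.sum =ᶠ[𝓝 (ρ + -d)] psSum b := by
      filter_upwards [Ioo_mem_nhds (show 0 < ρ + -d by linarith)
        (show ρ + -d < ρ by linarith)] with s hs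
      rw [Pi.sub_apply, ← hag s hs.1 hs.2, hPs, sub_eq_iff_eq_add, psSum, psSum,
        ← (hc s hs.1.le hs.2).sum_add_tsum_nat_add N,
        ← (hbc s hs.1.le hs.2).sum_add_tsum_nat_add N, add_comm]
      congr 1
      rw [Finset.sum_eq_zero, zero_add]
      · simp [b]
      · intro n hn
        simp [b, Finset.mem_range.1 hn]
    rw [hE.iteratedDeriv_eq k]
    exact iteratedDeriv_psSum_nonneg k hb hbc (by linarith) (by linarith)
  have hnn : 0 ≤ (g - P.sum) (ρ + -d + 2 * d) := by
    refine hsum.nonneg fun k => ?_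
    rw [FormalMultilinearSeries.ofScalars_apply_eq]
    exact mul_nonneg (div_nonneg (hpos k) (by positivity)) (by positivity)
  rw [show ρ + -d + 2 * d = ρ + d by ring, Pi.sub_apply, hPs] at hnn
  linarith

/-! ### The sum over all fully parked trees -/

theorem cars_eq : ∀ t : BinaryTree ℕ, AllParked t → cars t = visits t - 1 + t.numNodes
  | .nil, _ => by simp [cars, visits]
  | .node a l r, h => by
    obtain ⟨h0, hl, hr⟩ := h
    have h1 := cars_eq l hl
    have h2 := cars_eq r hr
    simp only [visits] at h0
    simp only [cars, visits, BinaryTree.numNodes]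
    omega

theorem weight_nonneg (μ : PMF ℕ) : ∀ t : BinaryTree ℕ, 0 ≤ weight μ t
  | .nil => zero_le_one
  | .node _ l r =>
    mul_nonneg (mul_nonneg ENNReal.toReal_nonneg (weight_nonneg μ l)) (weight_nonneg μ r)

open Classical in
/-- The contribution of a tree to `1 + F(x, y)`; the empty tree contributes `1`. -/
noncomputable def treeTerm (μ : PMF ℕ) (x y : ℝ) (t : BinaryTree ℕ) : ℝ :=
  if AllParked t then x ^ t.numNodes * y ^ (visits t - 1) * weight μ t else 0

theorem treeTerm_nil (μ : PMF ℕ) (x y : ℝ) : treeTerm μ x y .nil = 1 := by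
  simp [treeTerm, AllParked, visits, weight]

theorem treeTerm_nonneg (μ : PMF ℕ) {x y : ℝ} (hx : 0 ≤ x) (hy : 0 ≤ y) (t : BinaryTree ℕ) :
    0 ≤ treeTerm μ x y t := by
  unfold treeTerm
  split_ifs
  · have := weight_nonneg μ t
    positivity
  · exact le_rfl

theorem treeTerm_mono (μ : PMF ℕ) {x y s : ℝ} (hx : 0 ≤ x) (hy : 0 ≤ y) (hys : y ≤ s)
    (t : BinaryTree ℕ) : treeTerm μ x y t ≤ treeTerm μ x s t := by
  unfold treeTerm
  split_ifs
  · have := weight_nonneg μ t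
    gcongr
  · exact le_rfl

theorem continuous_treeTerm (μ : PMF ℕ) (x : ℝ) (t : BinaryTree ℕ) :
    Continuous fun y => treeTerm μ x y t := by
  unfold treeTerm
  split_ifs <;> fun_prop

/-- The recursive decomposition of a fully parked tree at its root. The subtracted term accounts
for the trees whose root is not visited although all the other vertices are occupied. -/
theorem mul_treeTerm_node (μ : PMF ℕ) (x y : ℝ) (a : ℕ) (l r : BinaryTree ℕ) :
    y * treeTerm μ x y (.node a l r) =
      x * ((μ a).toReal * y ^ a * (treeTerm μ x y l * treeTerm μ x y r)) -
        x * ((μ a).toReal * 0 ^ a * (treeTerm μ x 0 l * treeTerm μ x 0 r)) := by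
  unfold treeTerm
  by_cases hl : AllParked l
  swap
  · simp [hl, AllParked]
  by_cases hr : AllParked r
  swap
  · simp [hr, AllParked]
  by_cases h : 1 ≤ visits (.node a l r)
  · have hp : AllParked (.node a l r) := ⟨h, hl, hr⟩
    rw [if_pos hp, if_pos hl, if_pos hr, if_pos hl, if_pos hr]
    simp only [visits] at h
    -- The root is visited, so the total exponent of `0` is positive and the subtracted term
    -- vanishes.
    have h0 : (0 : ℝ) ^ a * (0 ^ (visits l - 1) * 0 ^ (visits r - 1)) = 0 := by
      rw [← pow_add, ← pow_add]
      exact zero_pow (by omega)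
    have h1 : y * y ^ (visits (.node a l r) - 1) =
        y ^ a * (y ^ (visits l - 1) * y ^ (visits r - 1)) := by
      rw [← pow_succ', ← pow_add, ← pow_add]
      simp only [visits]
      congr 1
      omega
    simp only [BinaryTree.numNodes, weight]
    linear_combination (x ^ (l.numNodes + r.numNodes + 1) *
      ((μ a).toReal * weight μ l * weight μ r)) * h1 + x * (μ a).toReal * x ^ l.numNodes *
      x ^ r.numNodes * weight μ l * weight μ r * h0
  · have hp : ¬ AllParked (.node a l r) := fun h' => h h'.1
    rw [if_neg hp, if_pos hl, if_pos hr, if_pos hl, if_pos hr]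
    simp only [visits] at h
    -- At an unvisited root there is no arrival and no incoming flux, so the two terms on the right
    -- coincide.
    have ha : a = 0 := by omega
    have hvl : visits l - 1 = 0 := by omega
    have hvr : visits r - 1 = 0 := by omega
    simp [ha, hvl, hvr]

/-! ### Summability -/

/-- The product weight of a decorated tree whose vertices have the weights `z a`. -/
def productWeight (z : ℕ → ℝ) : BinaryTree ℕ → ℝ
  | .nil => 1
  | .node a l r => z a * (productWeight z l * productWeight z r)

theorem productWeight_nonneg {z : ℕ → ℝ} (hz : ∀ a, 0 ≤ z a) :
    ∀ t : BinaryTree ℕ, 0 ≤ productWeight z t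
  | .nil => zero_le_one
  | .node a l r =>
    mul_nonneg (hz a) (mul_nonneg (productWeight_nonneg hz l) (productWeight_nonneg hz r))

/-- The decoration of the root (`0` for the empty tree). -/
def rootValue : BinaryTree ℕ → ℕ
  | .nil => 0
  | .node a _ _ => a

/-- Induction on the height: a finite set of trees lies in the empty tree plus a product of roots,
left and right subtrees, so the bound `B` passes to `1 + B ^ 2 / 4`. The value `2` is the fixed
point of this map, and `1 / 4` is the largest total vertex weight for which a fixed point exists. -/
theorem sum_productWeight_le {z : ℕ → ℝ} (hz : ∀ a, 0 ≤ z a) (hs : Summable z)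
    (h4 : ∑' a, z a ≤ 1 / 4) (N : ℕ) :
    ∀ S : Finset (BinaryTree ℕ), (∀ t ∈ S, t.height ≤ N) → ∑ t ∈ S, productWeight z t ≤ 2 := by
  classical
  induction N with
  | zero =>
    intro S hS
    have hsub : S ⊆ {BinaryTree.nil} := by
      rintro (_ | ⟨a, l, r⟩) ht
      · simp
      · have := hS _ ht
        simp [BinaryTree.height] at this
    calc ∑ t ∈ S, productWeight z t ≤ ∑ t ∈ {BinaryTree.nil}, productWeight z t :=
          Finset.sum_le_sum_of_subset_of_nonneg hsub fun t _ _ => productWeight_nonneg hz t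
      _ ≤ 2 := by simp [productWeight]
  | succ N ih =>
    intro S hS
    set A := S.image rootValue
    set L := S.image BinaryTree.left
    set R := S.image BinaryTree.right
    set e : ℕ × BinaryTree ℕ × BinaryTree ℕ → BinaryTree ℕ := fun q => .node q.1 q.2.1 q.2.2
    have he : Function.Injective e := by
      rintro ⟨a, l, r⟩ ⟨a', l', r'⟩ h
      simpa [e] using h
    have hsub : S ⊆ insert BinaryTree.nil ((A ×ˢ L ×ˢ R).image e) := by
      rintro (_ | ⟨a, l, r⟩) ht
      · simp
      · refine Finset.mem_insert_of_mem (Finset.mem_image.2 ⟨(a, l, r), ?_, rfl⟩)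
        simp only [Finset.mem_product]
        exact ⟨Finset.mem_image.2 ⟨_, ht, rfl⟩, Finset.mem_image.2 ⟨_, ht, rfl⟩,
          Finset.mem_image.2 ⟨_, ht, rfl⟩⟩
    have hL : ∑ t ∈ L, productWeight z t ≤ 2 := by
      refine ih L fun t ht => ?_
      obtain ⟨u, hu, rfl⟩ := Finset.mem_image.1 ht
      have := hS u hu
      cases u
      · simp [BinaryTree.left, BinaryTree.height]
      · simp only [BinaryTree.height, BinaryTree.left] at this ⊢
        omega
    have hR : ∑ t ∈ R, productWeight z t ≤ 2 := by
      refine ih R fun t ht => ?_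
      obtain ⟨u, hu, rfl⟩ := Finset.mem_image.1 ht
      have := hS u hu
      cases u
      · simp [BinaryTree.right, BinaryTree.height]
      · simp only [BinaryTree.height, BinaryTree.right] at this ⊢
        omega
    have hA : ∑ a ∈ A, z a ≤ 1 / 4 := (hs.sum_le_tsum A fun a _ => hz a).trans h4
    have hA0 : 0 ≤ ∑ a ∈ A, z a := Finset.sum_nonneg fun a _ => hz a
    have hR0 : 0 ≤ ∑ t ∈ R, productWeight z t :=
      Finset.sum_nonneg fun t _ => productWeight_nonneg hz t
    calc ∑ t ∈ S, productWeight z t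
        ≤ ∑ t ∈ insert BinaryTree.nil ((A ×ˢ L ×ˢ R).image e), productWeight z t :=
          Finset.sum_le_sum_of_subset_of_nonneg hsub fun t _ _ => productWeight_nonneg hz t
      _ = 1 + (∑ a ∈ A, z a) * ((∑ t ∈ L, productWeight z t) * ∑ t ∈ R, productWeight z t) := by
          rw [Finset.sum_insert (by simp [e]), Finset.sum_image he.injOn,
            Finset.sum_mul_sum L R, ← Finset.sum_product', Finset.sum_mul_sum,
            ← Finset.sum_product']
          rfl
      _ ≤ 1 + 1 / 4 * (2 * 2) := by
          have hL0 : 0 ≤ ∑ t ∈ L, productWeight z t :=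
            Finset.sum_nonneg fun t _ => productWeight_nonneg hz t
          gcongr
      _ = 2 := by norm_num

theorem summable_productWeight {z : ℕ → ℝ} (hz : ∀ a, 0 ≤ z a) (hs : Summable z)
    (h4 : ∑' a, z a ≤ 1 / 4) :
    Summable (productWeight z) ∧ ∑' t, productWeight z t ≤ 2 := by
  have hb : ∀ S : Finset (BinaryTree ℕ), ∑ t ∈ S, productWeight z t ≤ 2 := fun S =>
    sum_productWeight_le hz hs h4 (S.sup BinaryTree.height) S fun t ht => Finset.le_sup ht
  have hsum := summable_of_sum_le (productWeight_nonneg hz) hb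
  exact ⟨hsum, hsum.tsum_le_of_sum_le hb⟩

/-- In a fully parked tree the flux is the number of cars minus the number of vertices, so `x ^ n *
s ^ p` spreads over the vertices as factors `x / s * s ^ a`. The induction obtains the bound by
dropping the subtracted term of `mul_treeTerm_node`. -/
theorem treeTerm_le_productWeight (μ : PMF ℕ) {x s : ℝ} (hx : 0 ≤ x) (hs : 0 < s) :
    ∀ t : BinaryTree ℕ,
      treeTerm μ x s t ≤ productWeight (fun a => x / s * ((μ a).toReal * s ^ a)) t
  | .nil => by simp [treeTerm_nil, productWeight]
  | .node a l r => by
    have hl := treeTerm_le_productWeight μ hx hs l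
    have hr := treeTerm_le_productWeight μ hx hs r
    have h1 : s * treeTerm μ x s (.node a l r) ≤
        x * ((μ a).toReal * s ^ a * (treeTerm μ x s l * treeTerm μ x s r)) := by
      rw [mul_treeTerm_node, sub_le_self_iff]
      have := treeTerm_nonneg μ hx le_rfl l
      have := treeTerm_nonneg μ hx le_rfl r
      positivity
    have h0 := treeTerm_nonneg μ hx hs.le r
    have h0' := (treeTerm_nonneg μ hx hs.le l).trans hl
    calc treeTerm μ x s (.node a l r)
        ≤ x * ((μ a).toReal * s ^ a * (treeTerm μ x s l * treeTerm μ x s r)) / s := by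
          rw [le_div_iff₀ hs, mul_comm]
          exact h1
      _ = x / s * ((μ a).toReal * s ^ a) * (treeTerm μ x s l * treeTerm μ x s r) := by ring
      _ ≤ _ := by
          unfold productWeight
          gcongr

/-! ### The functional equation -/

theorem arrivalSeries_coeff_nonneg (μ : PMF ℕ) (n : ℕ) :
    0 ≤ PowerSeries.coeff n (arrivalSeries μ) := by
  simp [arrivalSeries]

theorem hasSum_G {μ : PMF ℕ} {y : ℝ} (h : PSConv (arrivalSeries μ) y) :
    HasSum (fun a => (μ a).toReal * y ^ a) (G μ y) := by
  simpa [arrivalSeries, G, psSum] using h.hasSum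

theorem summable_treeTerm {μ : PMF ℕ} {x s : ℝ} (hx : 0 ≤ x) (hs : 0 < s)
    (hc : PSConv (arrivalSeries μ) s) (h4 : 4 * x * G μ s ≤ s) :
    Summable (treeTerm μ x s) ∧ ∑' t, treeTerm μ x s t ≤ 2 := by
  have hz := (hasSum_G hc).mul_left (x / s)
  obtain ⟨h1, h2⟩ := summable_productWeight (z := fun a => x / s * ((μ a).toReal * s ^ a))
    (fun a => by positivity) hz.summable (by
      rw [hz.tsum_eq, div_mul_eq_mul_div, div_le_iff₀ hs]
      linarith)
  have h3 := Summable.of_nonneg_of_le (treeTerm_nonneg μ hx hs.le)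
    (treeTerm_le_productWeight μ hx hs) h1
  exact ⟨h3, (h3.tsum_le_tsum (treeTerm_le_productWeight μ hx hs) h1).trans h2⟩

/-- A nonempty tree consists of its root and two subtrees. -/
def treeEquiv : Option (ℕ × BinaryTree ℕ × BinaryTree ℕ) ≃ BinaryTree ℕ where
  toFun
    | none => .nil
    | some q => .node q.1 q.2.1 q.2.2
  invFun
    | .nil => none
    | .node a l r => some (a, l, r)
  left_inv q := by rcases q with _ | q <;> rfl
  right_inv t := by cases t <;> rfl

theorem hasSum_node {f : BinaryTree ℕ → ℝ} (hf : Summable f) :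
    HasSum (fun q : ℕ × BinaryTree ℕ × BinaryTree ℕ => f (.node q.1 q.2.1 q.2.2))
      (∑' t, f t - f .nil) := by
  have h1 : Summable (f ∘ treeEquiv) := treeEquiv.summable_iff.2 hf
  have h2 : Summable fun q : ℕ × BinaryTree ℕ × BinaryTree ℕ => f (.node q.1 q.2.1 q.2.2) :=
    h1.comp_injective (Option.some_injective _)
  have h3 : ∑' t, f t = f .nil + ∑' q : ℕ × BinaryTree ℕ × BinaryTree ℕ,
      f (.node q.1 q.2.1 q.2.2) := by
    classical
    rw [← treeEquiv.tsum_eq f]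
    refine (h1.tsum_eq_add_tsum_ite none).trans (congrArg₂ _ rfl ?_)
    rw [← (Option.some_injective _).tsum_eq]
    · rfl
    · rintro (_ | q) hq
      · simp at hq
      · exact ⟨q, rfl⟩
  rw [h3, add_sub_cancel_left]
  exact h2.hasSum

theorem hasSum_triple {μ : PMF ℕ} {x y : ℝ} (hx : 0 ≤ x) (hy : 0 ≤ y)
    (hc : PSConv (arrivalSeries μ) y) (hs : Summable (treeTerm μ x y)) :
    HasSum (fun q : ℕ × BinaryTree ℕ × BinaryTree ℕ =>
        x * ((μ q.1).toReal * y ^ q.1 * (treeTerm μ x y q.2.1 * treeTerm μ x y q.2.2)))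
      (x * (G μ y * ((∑' t, treeTerm μ x y t) * ∑' t, treeTerm μ x y t))) := by
  have h0 := treeTerm_nonneg μ hx hy
  have h1 := hs.hasSum.mul hs.hasSum (hs.mul_of_nonneg hs h0 h0)
  have hG := hasSum_G hc
  exact (hG.mul h1 (hG.summable.mul_of_nonneg h1.summable
    (fun a => mul_nonneg ENNReal.toReal_nonneg (pow_nonneg hy a))
    (fun q => mul_nonneg (h0 q.1) (h0 q.2)))).mul_left x

/-- This is `mul_treeTerm_node` summed over all triples (root label, left subtree, right subtree).
The empty tree is not of this form, whence the `- 1`. -/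
theorem functional_equation {μ : PMF ℕ} {x y : ℝ} (hx : 0 ≤ x) (hy : 0 ≤ y)
    (hc : PSConv (arrivalSeries μ) y) (hs : Summable (treeTerm μ x y)) :
    y * (∑' t, treeTerm μ x y t - 1) =
      x * (G μ y * ((∑' t, treeTerm μ x y t) * ∑' t, treeTerm μ x y t)) -
        x * (G μ 0 * ((∑' t, treeTerm μ x 0 t) * ∑' t, treeTerm μ x 0 t)) := by
  have hc0 := hc.mono (arrivalSeries_coeff_nonneg μ) le_rfl hy
  have hs0 := hs.of_nonneg_of_le (treeTerm_nonneg μ hx le_rfl) (treeTerm_mono μ hx le_rfl hy)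
  have h1 := (hasSum_node hs).mul_left y
  have h2 := (hasSum_triple hx hy hc hs).sub (hasSum_triple hx le_rfl hc0 hs0)
  rw [treeTerm_nil] at h1
  refine h1.unique (h2.congr_fun fun q => ?_)
  exact mul_treeTerm_node μ x y q.1 q.2.1 q.2.2

theorem coeff_F₀ (μ : PMF ℕ) (n : ℕ) : PowerSeries.coeff n (F₀ μ) =
    (if n = 0 then 1 else 0) + ∑ t ∈ (finite_fullyParkedTrees n 0).toFinset, weight μ t := by
  simp [F₀, fptSeries, PowerSeries.coeff_one]

theorem F₀_coeff_nonneg (μ : PMF ℕ) (n : ℕ) : 0 ≤ PowerSeries.coeff n (F₀ μ) := by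
  rw [coeff_F₀]
  refine add_nonneg (by split_ifs <;> norm_num) (Finset.sum_nonneg fun t _ => weight_nonneg μ t)

theorem one_le_coeff_F₀_zero (μ : PMF ℕ) : 1 ≤ PowerSeries.coeff 0 (F₀ μ) := by
  rw [coeff_F₀, if_pos rfl, le_add_iff_nonneg_right]
  exact Finset.sum_nonneg fun t _ => weight_nonneg μ t

theorem hasSum_F₀ {μ : PMF ℕ} {x : ℝ} (hs : Summable (treeTerm μ x 0)) :
    HasSum (fun n => PowerSeries.coeff n (F₀ μ) * x ^ n) (∑' t, treeTerm μ x 0 t) := by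
  classical
  refine (hs.hasSum.tsum_fiberwise BinaryTree.numNodes).congr_fun fun n => ?_
  rw [tsum_subtype (BinaryTree.numNodes ⁻¹' {n}) (treeTerm μ x 0),
    -- The empty tree has no visit and is not in `fullyParkedTrees`; it accounts for the `1` in
    -- `F₀`. Trees of positive flux contribute `0` at `y = 0`.
    tsum_eq_sum (s := insert .nil (finite_fullyParkedTrees n 0).toFinset)]
  · rw [Finset.sum_insert (by simp [fullyParkedTrees, visits]), coeff_F₀, add_mul, Finset.sum_mul]
    congr 1
    · by_cases hn : n = 0
      · subst hn
        simp [Set.indicator, treeTerm_nil]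
      · simp [Set.indicator, BinaryTree.numNodes, hn, Ne.symm hn]
    · refine Finset.sum_congr rfl fun t ht => ?_
      obtain ⟨h1, h2, h3⟩ := (Set.Finite.mem_toFinset _).1 ht
      rw [Set.indicator_of_mem (by exact h2), treeTerm, if_pos h1, h2, h3]
      simp [mul_comm]
  · intro t ht
    rw [Finset.mem_insert, Set.Finite.mem_toFinset, not_or] at ht
    refine Set.indicator_apply_eq_zero.2 fun hn => ?_
    unfold treeTerm
    split_ifs with hp
    · rcases t with _ | ⟨a, l, r⟩
      · exact absurd rfl ht.1
      · have h2 : visits (.node a l r) ≠ 0 + 1 := fun h => ht.2 ⟨hp, hn, h⟩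
        have h3 := hp.1
        rw [zero_pow (by omega)]
        simp
    · rfl

/-- The function `y ↦ 1 + F(x, y)` for small `x`. -/
theorem exists_solution {μ : PMF ℕ} {x s : ℝ} (hx : 0 ≤ x) (hs : 0 < s)
    (hc : PSConv (arrivalSeries μ) s) (h4 : 4 * x * G μ s ≤ s) :
    PSConv (F₀ μ) x ∧ ∃ Z : ℝ → ℝ, ContinuousOn Z (Set.Icc 0 s) ∧ Z 0 = psSum (F₀ μ) x ∧
      Z s ≤ 2 ∧ ∀ y ∈ Set.Icc 0 s,
        y * (Z y - 1) = x * G μ y * Z y ^ 2 - x * G μ 0 * psSum (F₀ μ) x ^ 2 := by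
  obtain ⟨h1, h2⟩ := summable_treeTerm hx hs hc h4
  have hsum : ∀ y, 0 ≤ y → y ≤ s → Summable (treeTerm μ x y) := fun y hy hys =>
    h1.of_nonneg_of_le (treeTerm_nonneg μ hx hy) (treeTerm_mono μ hx hy hys)
  have hF := hasSum_F₀ (hsum 0 le_rfl hs.le)
  have hF' : ∑' t, treeTerm μ x 0 t = psSum (F₀ μ) x := hF.tsum_eq.symm
  refine ⟨hF.summable, fun y => ∑' t, treeTerm μ x y t, ?_, hF', h2, fun y hy => ?_⟩
  · refine continuousOn_tsum (fun t => (continuous_treeTerm μ x t).continuousOn) h1 fun t y hy => ?_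
    rw [Real.norm_eq_abs, abs_of_nonneg (treeTerm_nonneg μ hx hy.1 t)]
    exact treeTerm_mono μ hx hy.1 hy.2 t
  · have := functional_equation hx hy.1
      (hc.mono (arrivalSeries_coeff_nonneg μ) hy.1 hy.2) (hsum y hy.1 hy.2)
    rw [hF'] at this
    rw [this]
    ring

/-! ### The generating function of the arrivals up to the critical point -/

theorem exists_two_le_apply_pos {μ : PMF ℕ} (hμ : μ 0 + μ 1 < 1) : ∃ k, 0 < (μ (k + 2)).toReal := by
  by_contra! h
  have h0 : ∀ k, μ (k + 2) = 0 := fun k => by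
    have := (ENNReal.toReal_eq_zero_iff _).1 (le_antisymm (h k) ENNReal.toReal_nonneg)
    exact this.resolve_right (μ.apply_ne_top _)
  have h1 : ∑' k, μ k = ∑ k ∈ Finset.range 2, μ k := tsum_eq_sum fun k hk => by
    obtain ⟨m, rfl⟩ := Nat.exists_eq_add_of_le' (not_lt.1 fun h => hk (Finset.mem_range.2 h))
    exact h0 m
  rw [μ.tsum_coe, Finset.sum_range_succ, Finset.sum_range_one] at h1
  exact hμ.ne h1.symm

theorem G'_coeff_nonneg (μ : PMF ℕ) (n : ℕ) :
    0 ≤ PowerSeries.coeff n (PowerSeries.derivative ℝ (arrivalSeries μ)) :=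
  coeff_derivative_nonneg (arrivalSeries_coeff_nonneg μ) n

theorem G''_coeff_nonneg (μ : PMF ℕ) (n : ℕ) : 0 ≤ PowerSeries.coeff n
    (PowerSeries.derivative ℝ (PowerSeries.derivative ℝ (arrivalSeries μ))) :=
  coeff_derivative_nonneg (G'_coeff_nonneg μ) n

/-- The difference of the two sides of `(⋆)`. -/
noncomputable def starGap (μ : PMF ℕ) (t : ℝ) : ℝ :=
  2 * (G μ t - t * G' μ t) ^ 2 - t ^ 2 * G μ t * G'' μ t

section Star

variable {μ : PMF ℕ} {tc t : ℝ}

theorem Star.psConv (h : Star μ tc) (h0 : 0 ≤ t) (ht : t ≤ tc) : PSConv (arrivalSeries μ) t :=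
  h.2.1.2.1.mono (arrivalSeries_coeff_nonneg μ) h0 ht

theorem Star.psConv' (h : Star μ tc) (h0 : 0 ≤ t) (ht : t ≤ tc) :
    PSConv (PowerSeries.derivative ℝ (arrivalSeries μ)) t :=
  h.2.1.2.2.1.mono (G'_coeff_nonneg μ) h0 ht

theorem Star.psConv'' (h : Star μ tc) (h0 : 0 ≤ t) (ht : t ≤ tc) :
    PSConv (PowerSeries.derivative ℝ (PowerSeries.derivative ℝ (arrivalSeries μ))) t :=
  h.2.1.2.2.2.1.mono (G''_coeff_nonneg μ) h0 ht

theorem Star.continuousOn_G (h : Star μ tc) : ContinuousOn (G μ) (Set.Icc 0 tc) :=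
  (h.psConv h.1.le le_rfl).continuousOn (arrivalSeries_coeff_nonneg μ)

theorem Star.continuousOn_G' (h : Star μ tc) : ContinuousOn (G' μ) (Set.Icc 0 tc) :=
  (h.psConv' h.1.le le_rfl).continuousOn (G'_coeff_nonneg μ)

theorem Star.continuousOn_G'' (h : Star μ tc) : ContinuousOn (G'' μ) (Set.Icc 0 tc) :=
  (h.psConv'' h.1.le le_rfl).continuousOn (G''_coeff_nonneg μ)

theorem Star.hasDerivAt_G (h : Star μ tc) (h0 : 0 < t) (ht : t < tc) :
    HasDerivAt (G μ) (G' μ t) t :=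
  hasDerivAt_psSum (arrivalSeries_coeff_nonneg μ) h0 ht (h.psConv h.1.le le_rfl)

theorem Star.hasDerivAt_G' (h : Star μ tc) (h0 : 0 < t) (ht : t < tc) :
    HasDerivAt (G' μ) (G'' μ t) t :=
  hasDerivAt_psSum (G'_coeff_nonneg μ) h0 ht (h.psConv' h.1.le le_rfl)

theorem Star.analyticAt_G (h : Star μ tc) (h0 : 0 ≤ t) (ht : t < tc) : AnalyticAt ℝ (G μ) t :=
  (h.psConv h.1.le le_rfl).analyticAt h0 ht

theorem Star.analyticAt_G' (h : Star μ tc) (h0 : 0 ≤ t) (ht : t < tc) : AnalyticAt ℝ (G' μ) t :=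
  (h.psConv' h.1.le le_rfl).analyticAt h0 ht

theorem G''_nonneg (μ : PMF ℕ) (h0 : 0 ≤ t) : 0 ≤ G'' μ t := psSum_nonneg (G''_coeff_nonneg μ) h0

/-- If `G μ 0` were zero, both sides of (⋆) would vanish at `0`, against the minimality of `tc > 0`.
-/
theorem Star.G_zero_pos (h : Star μ tc) : 0 < G μ 0 := by
  refine lt_of_le_of_ne (psSum_nonneg (arrivalSeries_coeff_nonneg μ) le_rfl) fun h0 => ?_
  have hmem : (0 : ℝ) ∈ starSet μ :=
    ⟨le_rfl, h.psConv le_rfl h.1.le, h.psConv' le_rfl h.1.le, h.psConv'' le_rfl h.1.le, by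
      rw [← h0]; ring⟩
  exact (h.2.2 hmem).not_gt h.1

theorem Star.G_pos (h : Star μ tc) (h0 : 0 ≤ t) (ht : t ≤ tc) : 0 < G μ t := by
  have h1 := le_psSum (arrivalSeries_coeff_nonneg μ) h0 (h.psConv h0 ht) 0
  rw [pow_zero, mul_one, ← psSum_zero] at h1
  exact h.G_zero_pos.trans_le h1

theorem Star.G''_pos (h : Star μ tc) (hμ : μ 0 + μ 1 < 1) (h0 : 0 < t) (ht : t ≤ tc) :
    0 < G'' μ t := by
  obtain ⟨k, hk⟩ := exists_two_le_apply_pos hμ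
  refine lt_of_lt_of_le ?_ (le_psSum (G''_coeff_nonneg μ) h0.le (h.psConv'' h0.le ht) k)
  rw [PowerSeries.coeff_derivative, PowerSeries.coeff_derivative, arrivalSeries,
    PowerSeries.coeff_mk]
  have : 0 < (μ (k + 1 + 1)).toReal := hk
  positivity

theorem Star.G'_pos (h : Star μ tc) (hμ : μ 0 + μ 1 < 1) (h0 : 0 < t) (ht : t ≤ tc) :
    0 < G' μ t := by
  obtain ⟨k, hk⟩ := exists_two_le_apply_pos hμ
  refine lt_of_lt_of_le ?_ (le_psSum (G'_coeff_nonneg μ) h0.le (h.psConv' h0.le ht) (k + 1))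
  rw [PowerSeries.coeff_derivative, arrivalSeries, PowerSeries.coeff_mk]
  have : 0 < (μ (k + 1 + 1)).toReal := hk
  positivity

theorem Star.continuousOn_starGap (h : Star μ tc) : ContinuousOn (starGap μ) (Set.Icc 0 tc) := by
  have h1 := h.continuousOn_G
  have h2 := h.continuousOn_G'
  have h3 := h.continuousOn_G''
  unfold starGap
  fun_prop

theorem Star.starGap_eq_zero (h : Star μ tc) : starGap μ tc = 0 :=
  sub_eq_zero.2 h.2.1.2.2.2.2

/-- The gap is nonnegative at `0`; a nonpositive value before `tc` would produce a zero smaller than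
the least one. -/
theorem Star.starGap_pos (h : Star μ tc) (h0 : 0 ≤ t) (ht : t < tc) : 0 < starGap μ t := by
  by_contra! hneg
  have hz : 0 ≤ starGap μ 0 := by
    unfold starGap
    have : 0 ≤ 2 * (G μ 0 - 0 * G' μ 0) ^ 2 := by positivity
    simpa using this
  obtain ⟨s, hs, hs0⟩ := intermediate_value_Icc' h0
    (h.continuousOn_starGap.mono (Set.Icc_subset_Icc_right ht.le)) ⟨hneg, hz⟩
  have hsc : s ≤ tc := hs.2.trans ht.le
  have hmem : s ∈ starSet μ := ⟨hs.1, h.psConv hs.1 hsc, h.psConv' hs.1 hsc, h.psConv'' hs.1 hsc,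
    sub_eq_zero.1 hs0⟩
  exact (h.2.2 hmem).not_gt (hs.2.trans_lt ht)

/-- At a first failure `G - t G'` would vanish, and the gap would equal `-t² G G''`. This
contradicts the positivity of the gap before `tc`, and at `tc`, where the gap is zero, it
contradicts `G'' > 0`. -/
theorem Star.sub_mul_pos (h : Star μ tc) (hμ : μ 0 + μ 1 < 1) (h0 : 0 ≤ t) (ht : t ≤ tc) :
    0 < G μ t - t * G' μ t := by
  by_contra! hneg
  have hz : 0 ≤ G μ 0 - 0 * G' μ 0 := by simpa using h.G_zero_pos.le
  have hcont : ContinuousOn (fun t => G μ t - t * G' μ t) (Set.Icc 0 tc) := by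
    have h1 := h.continuousOn_G
    have h2 := h.continuousOn_G'
    fun_prop
  obtain ⟨s, hs, hs0⟩ := intermediate_value_Icc' h0
    (hcont.mono (Set.Icc_subset_Icc_right ht)) ⟨hneg, hz⟩
  have hsc : s ≤ tc := hs.2.trans ht
  have hgap : starGap μ s = -(s ^ 2 * G μ s * G'' μ s) := by
    unfold starGap
    rw [show G μ s - s * G' μ s = 0 from hs0]
    ring
  have hG := h.G_pos hs.1 hsc
  rcases hsc.lt_or_eq with hlt | rfl
  · have h1 := h.starGap_pos hs.1 hlt
    have h2 := G''_nonneg μ hs.1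
    rw [hgap] at h1
    have : 0 ≤ s ^ 2 * G μ s * G'' μ s := by positivity
    linarith
  · have h2 := h.G''_pos hμ h.1 le_rfl
    have h1 := h.starGap_eq_zero
    have h3 := h.1
    rw [hgap] at h1
    have : 0 < s ^ 2 * G μ s * G'' μ s := by positivity
    linarith

theorem Star.two_mul_sub_pos (h : Star μ tc) (hμ : μ 0 + μ 1 < 1) (h0 : 0 ≤ t) (ht : t ≤ tc) :
    0 < 2 * G μ t - t * G' μ t := by
  linarith [h.sub_mul_pos hμ h0 ht, h.G_pos h0 ht]

/-! ### The parametrization by `ψ` -/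

theorem psi_zero (μ : PMF ℕ) : psi μ 0 = 0 := by simp [psi]

theorem Star.psi_pos (h : Star μ tc) (hμ : μ 0 + μ 1 < 1) (h0 : 0 < t) (ht : t ≤ tc) :
    0 < psi μ t := by
  have h1 := h.two_mul_sub_pos hμ h0.le ht
  have h2 := h.G_pos h0.le ht
  unfold psi
  positivity

theorem Star.continuousOn_psi (h : Star μ tc) : ContinuousOn (psi μ) (Set.Icc 0 tc) := by
  have h1 := h.continuousOn_G
  have h2 := h.continuousOn_G'
  unfold psi
  refine ContinuousOn.div (by fun_prop) (by fun_prop) fun t ht => ?_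
  have := h.G_pos ht.1 ht.2
  positivity

/-- The derivative of `ψ`. -/
noncomputable def psiDeriv (μ : PMF ℕ) (t : ℝ) : ℝ := starGap μ t / (4 * G μ t ^ 3)

/-- Condition (⋆) is thus the equation for a critical point of ψ. -/
theorem Star.hasDerivAt_psi (h : Star μ tc) (h0 : 0 < t) (ht : t < tc) :
    HasDerivAt (psi μ) (psiDeriv μ t) t := by
  have hG := h.hasDerivAt_G h0 ht
  have hG' := h.hasDerivAt_G' h0 ht
  have hp := h.G_pos h0.le ht.le
  have h1 := ((hasDerivAt_id' t).mul ((hG.const_mul 2).sub ((hasDerivAt_id' t).mul hG'))).div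
    ((hG.pow 2).const_mul 4)
    (show 4 * G μ t ^ 2 ≠ 0 by positivity)
  refine h1.congr_deriv ?_
  unfold psiDeriv starGap
  simp only [Pi.sub_apply, Pi.mul_apply, Pi.pow_apply]
  field_simp
  ring

theorem Star.psiDeriv_pos (h : Star μ tc) (h0 : 0 ≤ t) (ht : t < tc) : 0 < psiDeriv μ t := by
  have h1 := h.starGap_pos h0 ht
  have h2 := h.G_pos h0 ht.le
  unfold psiDeriv
  positivity

theorem Star.strictMonoOn_psi (h : Star μ tc) : StrictMonoOn (psi μ) (Set.Icc 0 tc) := by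
  refine strictMonoOn_of_deriv_pos (convex_Icc 0 tc) h.continuousOn_psi fun t ht => ?_
  rw [interior_Icc] at ht
  rw [(h.hasDerivAt_psi ht.1 ht.2).deriv]
  exact h.psiDeriv_pos ht.1.le ht.2

theorem Star.tendsto_psiDeriv (h : Star μ tc) : Tendsto (psiDeriv μ) (𝓝[<] tc) (𝓝[>] 0) := by
  have h1 : Set.Ioo 0 tc ∈ 𝓝[<] tc := Ioo_mem_nhdsLT h.1
  refine tendsto_nhdsWithin_iff.2 ⟨?_, ?_⟩
  · have hc : ContinuousOn (psiDeriv μ) (Set.Icc 0 tc) := by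
      have h1 := h.continuousOn_starGap
      have h2 := h.continuousOn_G
      unfold psiDeriv
      refine h1.div (by fun_prop) fun t ht => ?_
      have := h.G_pos ht.1 ht.2
      positivity
    have h2 := (hc tc ⟨h.1.le, le_rfl⟩).tendsto.mono_left
      (nhdsWithin_le_of_mem (mem_of_superset h1 Set.Ioo_subset_Icc_self))
    simpa [psiDeriv, h.starGap_eq_zero] using h2
  · filter_upwards [h1] with t ht using h.psiDeriv_pos ht.1.le ht.2

/-- The value of `F₀` at `ψ(y)`. -/
noncomputable def Phi (μ : PMF ℕ) (y : ℝ) : ℝ :=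
  2 * G μ y * √(G μ y - y * G' μ y) / ((2 * G μ y - y * G' μ y) * √(G μ 0))

/-- The value of `F₀'` at `ψ(y)`. -/
noncomputable def PhiSlope (μ : PMF ℕ) (y : ℝ) : ℝ :=
  4 * G μ y ^ 3 * G' μ y /
    ((2 * G μ y - y * G' μ y) ^ 2 * √(G μ y - y * G' μ y) * √(G μ 0))

/-- The derivative of `PhiSlope`. -/
noncomputable def PhiSlopeDeriv (μ : PMF ℕ) (y : ℝ) : ℝ :=
  4 * G μ y ^ 2 * (G' μ y ^ 2 * (G μ y - y * G' μ y) * (G μ y + 3 * (G μ y - y * G' μ y)) +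
      G μ y * G'' μ y * (2 * G μ y - y * G' μ y) * (G μ y - y * G' μ y) +
      2 * G μ y * G' μ y * y * G'' μ y * (G μ y - y * G' μ y) +
      G μ y * G' μ y * (2 * G μ y - y * G' μ y) * y * G'' μ y / 2) /
    ((2 * G μ y - y * G' μ y) ^ 3 * (G μ y - y * G' μ y) * √(G μ y - y * G' μ y) * √(G μ 0))

theorem Star.continuousOn_Phi (h : Star μ tc) (hμ : μ 0 + μ 1 < 1) :
    ContinuousOn (Phi μ) (Set.Icc 0 tc) := by
  have h1 := h.continuousOn_G
  have h2 := h.continuousOn_G'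
  unfold Phi
  refine ContinuousOn.div (by fun_prop) (by fun_prop) fun t ht => ?_
  have := h.two_mul_sub_pos hμ ht.1 ht.2
  have := h.G_zero_pos
  positivity

theorem Star.analyticAt_psi (h : Star μ tc) (h0 : 0 ≤ t) (ht : t < tc) :
    AnalyticAt ℝ (psi μ) t := by
  have h1 := h.analyticAt_G h0 ht
  have h2 := h.analyticAt_G' h0 ht
  have := h.G_pos h0 ht.le
  unfold psi
  exact AnalyticAt.div (by fun_prop) (by fun_prop) (by positivity)

theorem Star.analyticAt_Phi (h : Star μ tc) (hμ : μ 0 + μ 1 < 1) (h0 : 0 ≤ t) (ht : t < tc) :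
    AnalyticAt ℝ (Phi μ) t := by
  have h1 := h.analyticAt_G h0 ht
  have h2 := h.analyticAt_G' h0 ht
  have h3 := h.two_mul_sub_pos hμ h0 ht.le
  have h4 := h.G_zero_pos
  have h5 := h.sub_mul_pos hμ h0 ht.le
  have h6 : AnalyticAt ℝ (fun y => √(G μ y - y * G' μ y)) t := by
    have h7 : AnalyticAt ℝ (fun x : ℝ => √x) (G μ t - t * G' μ t) :=
      (Real.contDiffAt_sqrt h5.ne').analyticAt
    exact h7.fun_comp (f := fun y => G μ y - y * G' μ y) (by fun_prop)
  unfold Phi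
  exact AnalyticAt.div (by fun_prop) (by fun_prop) (by positivity)

theorem Star.hasDerivAt_sqrt (h : Star μ tc) (hμ : μ 0 + μ 1 < 1) (h0 : 0 < t) (ht : t < tc) :
    HasDerivAt (fun y => √(G μ y - y * G' μ y)) (-(t * G'' μ t) / (2 * √(G μ t - t * G' μ t)))
      t := by
  have h1 := (h.hasDerivAt_G h0 ht).sub ((hasDerivAt_id' t).mul (h.hasDerivAt_G' h0 ht))
  refine (h1.sqrt (h.sub_mul_pos hμ h0.le ht.le).ne').congr_deriv ?_
  simp only [Pi.sub_apply, Pi.mul_apply]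
  congr 1
  ring

/-- The gap in (⋆) factors out of the derivative of `Phi`; this cancellation keeps the first
derivative of `F₀` finite at the critical point. -/
theorem Star.hasDerivAt_Phi (h : Star μ tc) (hμ : μ 0 + μ 1 < 1) (h0 : 0 < t) (ht : t < tc) :
    HasDerivAt (Phi μ) (PhiSlope μ t * psiDeriv μ t) t := by
  have hG := h.hasDerivAt_G h0 ht
  have hG' := h.hasDerivAt_G' h0 ht
  have hS := h.hasDerivAt_sqrt hμ h0 ht
  have hp := h.G_pos h0.le ht.le
  have hq := h.two_mul_sub_pos hμ h0.le ht.le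
  have hd := h.sub_mul_pos hμ h0.le ht.le
  have hm := Real.sqrt_pos.2 h.G_zero_pos
  have hs := Real.sqrt_pos.2 hd
  have hs2 := Real.sq_sqrt hd.le
  have h1 := ((hG.const_mul 2).mul hS).div
    (((hG.const_mul 2).sub ((hasDerivAt_id' t).mul hG')).mul_const (√(G μ 0)))
    (show (2 * G μ t - t * G' μ t) * √(G μ 0) ≠ 0 by positivity)
  refine h1.congr_deriv ?_
  unfold PhiSlope psiDeriv starGap
  simp only [Pi.sub_apply, Pi.mul_apply]
  -- The root becomes an indeterminate subject only to `hs2`, which leaves a polynomial identity.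
  generalize √(G μ t - t * G' μ t) = s at *
  have hq' := hq.ne'
  field_simp
  rw [hs2]
  congr 1
  ring

theorem Star.hasDerivAt_PhiSlope (h : Star μ tc) (hμ : μ 0 + μ 1 < 1) (h0 : 0 < t) (ht : t < tc) :
    HasDerivAt (PhiSlope μ) (PhiSlopeDeriv μ t) t := by
  have hG := h.hasDerivAt_G h0 ht
  have hG' := h.hasDerivAt_G' h0 ht
  have hS := h.hasDerivAt_sqrt hμ h0 ht
  have hp := h.G_pos h0.le ht.le
  have hq := h.two_mul_sub_pos hμ h0.le ht.le
  have hd := h.sub_mul_pos hμ h0.le ht.le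
  have hm := Real.sqrt_pos.2 h.G_zero_pos
  have hs := Real.sqrt_pos.2 hd
  have hs2 := Real.sq_sqrt hd.le
  have h1 := (((hG.pow 3).const_mul 4).mul hG').div
    (((((hG.const_mul 2).sub ((hasDerivAt_id' t).mul hG')).pow 2).mul hS).mul_const (√(G μ 0)))
    (show (2 * G μ t - t * G' μ t) ^ 2 * √(G μ t - t * G' μ t) * √(G μ 0) ≠ 0 by positivity)
  refine h1.congr_deriv ?_
  unfold PhiSlopeDeriv
  simp only [Pi.sub_apply, Pi.mul_apply, Pi.pow_apply]
  have hq' := hq.ne'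
  have hd' := hd.ne'
  generalize √(G μ t - t * G' μ t) = s at *
  field_simp
  rw [hs2, div_eq_div_iff (pow_ne_zero _ (by linarith)) (mul_ne_zero (pow_ne_zero _ (by linarith))
    (by linarith))]
  simp only [Nat.cast_ofNat, Nat.add_one_sub_one, pow_one]
  ring

/-- The numerator of `PhiSlopeDeriv` is written as a sum of products of positive quantities, so no
cancellation can occur at `tc`. -/
theorem Star.tendsto_PhiSlopeDeriv (h : Star μ tc) (hμ : μ 0 + μ 1 < 1) :
    ∃ c > 0, Tendsto (PhiSlopeDeriv μ) (𝓝[<] tc) (𝓝 c) := by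
  refine ⟨PhiSlopeDeriv μ tc, ?_, ?_⟩
  · have hp := h.G_pos h.1.le le_rfl
    have hp' := h.G'_pos hμ h.1 le_rfl
    have hp'' := h.G''_pos hμ h.1 le_rfl
    have hq := h.two_mul_sub_pos hμ h.1.le le_rfl
    have hd := h.sub_mul_pos hμ h.1.le le_rfl
    have hm := h.G_zero_pos
    have ht := h.1
    unfold PhiSlopeDeriv
    positivity
  · have hc : ContinuousOn (PhiSlopeDeriv μ) (Set.Icc 0 tc) := by
      have h1 := h.continuousOn_G
      have h2 := h.continuousOn_G'
      have h3 := h.continuousOn_G''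
      unfold PhiSlopeDeriv
      refine ContinuousOn.div (by fun_prop) (by fun_prop) fun t ht => ?_
      have hq := h.two_mul_sub_pos hμ ht.1 ht.2
      have hd := h.sub_mul_pos hμ ht.1 ht.2
      have hm := h.G_zero_pos
      positivity
    exact (hc tc ⟨h.1.le, le_rfl⟩).tendsto.mono_left (nhdsWithin_le_of_mem
      (mem_of_superset (Ioo_mem_nhdsLT h.1) Set.Ioo_subset_Icc_self))

end Star

/-! ### Power series inside the disc of convergence and at its endpoint -/

theorem psConv_of_lt_psRadius {f : ℝ⟦X⟧} {x : ℝ} (hx : 0 ≤ x)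
    (h : ENNReal.ofReal x < psRadius f) : PSConv f x := by
  have hm : x ∈ Metric.eball (0 : ℝ) (psRadius f) := by
    rw [Metric.mem_eball, edist_dist, Real.dist_eq, sub_zero, abs_of_nonneg hx]
    exact h
  refine ((hasFPowerSeriesOnBall_psSum (bot_le.trans_lt h)).hasSum hm).summable.congr fun n => ?_
  simp [mul_comm]

/-- A form of Abel's theorem for series with nonnegative coefficients, which yields the
convergence at the endpoint as well. -/
theorem hasSum_of_tendsto_psSum {f : ℝ⟦X⟧} (hf : ∀ n, 0 ≤ PowerSeries.coeff n f) {t L : ℝ}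
    (ht : 0 < t) (hc : ∀ s, 0 ≤ s → s < t → PSConv f s)
    (hL : Tendsto (psSum f) (𝓝[<] t) (𝓝 L)) :
    HasSum (fun n => PowerSeries.coeff n f * t ^ n) L := by
  have hI : Set.Ioo 0 t ∈ 𝓝[<] t := Ioo_mem_nhdsLT ht
  have hconv : PSConv f t := by
    -- Each partial sum at `t` is the limit of partial sums at `s < t`, which are at most `psSum f
    -- s`, and this tends to `L`.
    refine summable_of_sum_range_le (c := L) (fun n => mul_nonneg (hf n) (by positivity))
      fun N => ?_
    have h1 : Tendsto (fun s : ℝ => ∑ n ∈ Finset.range N, PowerSeries.coeff n f * s ^ n)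
        (𝓝[<] t) (𝓝 (∑ n ∈ Finset.range N, PowerSeries.coeff n f * t ^ n)) :=
      (Continuous.tendsto (by fun_prop) t).mono_left nhdsWithin_le_nhds
    refine le_of_tendsto_of_tendsto h1 hL ?_
    filter_upwards [hI] with s hs
    exact (hc s hs.1.le hs.2).sum_le_tsum _ fun n _ => mul_nonneg (hf n) (pow_nonneg hs.1.le n)
  have h2 := (hconv.continuousOn hf t ⟨ht.le, le_rfl⟩).tendsto.mono_left
    (nhdsWithin_le_of_mem (mem_of_superset hI Set.Ioo_subset_Icc_self))
  rw [tendsto_nhds_unique hL h2]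
  exact hconv.hasSum

theorem one_le_psSum_F₀ {μ : PMF ℕ} {x : ℝ} (hx : 0 ≤ x) (h : PSConv (F₀ μ) x) :
    1 ≤ psSum (F₀ μ) x := by
  have h1 := le_psSum (F₀_coeff_nonneg μ) hx h 0
  rw [pow_zero, mul_one] at h1
  exact (one_le_coeff_F₀_zero μ).trans h1

/-! ### The double zero of the discriminant -/

section Star

variable {μ : PMF ℕ} {tc : ℝ}

/-- The quadratic method: for small `x`, the discriminant of the functional equation has a double
zero. -/
theorem Star.exists_double_root (h : Star μ tc) {x : ℝ} (hx : 0 < x)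
    (h4 : 4 * x * G μ tc < tc) : PSConv (F₀ μ) x ∧ ∃ y ∈ Set.Ioo 0 tc,
      y ^ 2 - 4 * x * y * G μ y + 4 * x ^ 2 * G μ 0 * psSum (F₀ μ) x ^ 2 * G μ y = 0 ∧
      2 * y - 4 * x * (G μ y + y * G' μ y) +
        4 * x ^ 2 * G μ 0 * psSum (F₀ μ) x ^ 2 * G' μ y = 0 := by
  obtain ⟨hF, Z, hZc, hZ0, hZs, hZ⟩ :=
    exists_solution hx.le h.1 (h.psConv h.1.le le_rfl) h4.le
  refine ⟨hF, ?_⟩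
  -- Up to sign, `A` is the derivative in `Z` of the quadratic equation, so its square is the
  -- discriminant.
  set A : ℝ → ℝ := fun y => y - 2 * x * G μ y * Z y
  have hA : ContinuousOn A (Set.Icc 0 tc) := by
    have := h.continuousOn_G
    fun_prop
  have hsq : ∀ y ∈ Set.Icc 0 tc, y ^ 2 - 4 * x * y * G μ y +
      4 * x ^ 2 * G μ 0 * psSum (F₀ μ) x ^ 2 * G μ y = A y ^ 2 := fun y hy => by
    simp only [A]
    linear_combination (4 * x * G μ y) * hZ y hy
  have hA0 : A 0 < 0 := by
    have h1 := h.G_zero_pos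
    have h2 := one_le_psSum_F₀ hx.le hF
    have : 0 < 2 * x * G μ 0 * psSum (F₀ μ) x := by positivity
    simp only [A, hZ0]
    linarith
  have hAt : 0 < A tc := by
    have h1 := h.G_pos h.1.le le_rfl
    have : 2 * x * G μ tc * Z tc ≤ 2 * x * G μ tc * 2 := by gcongr
    simp only [A]
    linarith
  obtain ⟨y, hy, hy0⟩ := intermediate_value_Ioo h.1.le hA ⟨hA0, hAt⟩
  refine ⟨y, hy, by rw [hsq y (Set.Ioo_subset_Icc_self hy), hy0]; ring, ?_⟩
  -- The discriminant is a square on the interval, so its zero is a minimum and its derivative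
  -- vanishes as well.
  have hmin : IsLocalMin (fun y => y ^ 2 - 4 * x * y * G μ y +
      4 * x ^ 2 * G μ 0 * psSum (F₀ μ) x ^ 2 * G μ y) y := by
    filter_upwards [Ioo_mem_nhds hy.1 hy.2] with z hz
    have hAy : A y ^ 2 = 0 := by rw [hy0, zero_pow two_ne_zero]
    exact ((hsq y (Set.Ioo_subset_Icc_self hy)).trans hAy).trans_le
      ((sq_nonneg (A z)).trans_eq (hsq z (Set.Ioo_subset_Icc_self hz)).symm)
  have hG := h.hasDerivAt_G hy.1 hy.2
  have hd := ((hasDerivAt_pow 2 y).sub (((hasDerivAt_id' y).const_mul (4 * x)).mul hG)).add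
    (hG.const_mul (4 * x ^ 2 * G μ 0 * psSum (F₀ μ) x ^ 2))
  have h0 := hmin.hasDerivAt_eq_zero hd
  push_cast at h0
  linear_combination h0

/-- The two equations are linear in `x` and in `x² G(0) 𝐅₀(x)²`. Eliminating the latter gives `x`;
the first equation then gives the square of `𝐅₀(x)`, and positivity selects the root. -/
theorem Star.exists_psi_eq (h : Star μ tc) (hμ : μ 0 + μ 1 < 1) {x : ℝ} (hx : 0 < x)
    (h4 : 4 * x * G μ tc < tc) : PSConv (F₀ μ) x ∧ ∃ y ∈ Set.Ioo 0 tc,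
      psi μ y = x ∧ psSum (F₀ μ) x = Phi μ y := by
  obtain ⟨hF, y, hy, h1, h2⟩ := h.exists_double_root hx h4
  refine ⟨hF, y, hy, ?_⟩
  have hG := h.G_pos hy.1.le hy.2.le
  have hq := h.two_mul_sub_pos hμ hy.1.le hy.2.le
  have hd := h.sub_mul_pos hμ hy.1.le hy.2.le
  have hy0 := hy.1
  have hpsi : psi μ y = x := by
    unfold psi
    rw [div_eq_iff (by positivity)]
    linear_combination G μ y * h2 - G' μ y * h1
  refine ⟨hpsi, ?_⟩
  have h0 := h.G_zero_pos
  have hF1 := one_le_psSum_F₀ hx.le hF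
  have hP : 0 ≤ Phi μ y := by unfold Phi; positivity
  refine (sq_eq_sq₀ (by linarith) hP).1 ?_
  have h3 : psSum (F₀ μ) x ^ 2 = (4 * x * y * G μ y - y ^ 2) / (4 * x ^ 2 * G μ 0 * G μ y) := by
    rw [eq_div_iff (by positivity)]
    linear_combination h1
  have hPsq : Phi μ y ^ 2 = (2 * G μ y) ^ 2 * (G μ y - y * G' μ y) /
      ((2 * G μ y - y * G' μ y) ^ 2 * G μ 0) := by
    rw [Phi, div_pow, mul_pow, mul_pow (_ - _), Real.sq_sqrt hd.le, Real.sq_sqrt h0.le]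
  have hq' := hq.ne'
  rw [h3, ← hpsi, hPsq, psi]
  field_simp
  ring

/-! ### Inverting ψ and differentiating in `x` -/

theorem Star.surjOn_psi (h : Star μ tc) {x : ℝ} (hx : x ∈ Set.Ioo 0 (psi μ tc)) :
    ∃ y ∈ Set.Ioo 0 tc, psi μ y = x := by
  have := intermediate_value_Ioo h.1.le h.continuousOn_psi
  rw [psi_zero] at this
  exact this hx

/-- The inverse of `ψ` on `(0, t_c)`. -/
noncomputable def psiInv (μ : PMF ℕ) (tc : ℝ) : ℝ → ℝ :=
  Function.invFunOn (psi μ) (Set.Ioo 0 tc)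

theorem Star.psiInv_psi (h : Star μ tc) {y : ℝ} (hy : y ∈ Set.Ioo 0 tc) :
    psiInv μ tc (psi μ y) = y :=
  (h.strictMonoOn_psi.injOn.mono Set.Ioo_subset_Icc_self).leftInvOn_invFunOn hy

theorem Star.psi_mem (h : Star μ tc) (hμ : μ 0 + μ 1 < 1) {y : ℝ} (hy : y ∈ Set.Ioo 0 tc) :
    psi μ y ∈ Set.Ioo 0 (psi μ tc) :=
  ⟨h.psi_pos hμ hy.1 hy.2.le,
    h.strictMonoOn_psi (Set.Ioo_subset_Icc_self hy) ⟨h.1.le, le_rfl⟩ hy.2⟩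

theorem Star.tendsto_psiInv (h : Star μ tc) (hμ : μ 0 + μ 1 < 1) :
    Tendsto (psiInv μ tc) (𝓝[<] (psi μ tc)) (𝓝[<] tc) := by
  have hxc := h.psi_pos hμ h.1 le_rfl
  rw [tendsto_nhdsWithin_iff]
  have hI : Set.Ioo 0 (psi μ tc) ∈ 𝓝[<] (psi μ tc) := Ioo_mem_nhdsLT hxc
  have hlt : ∀ᶠ x in 𝓝[<] (psi μ tc), psiInv μ tc x < tc := by
    filter_upwards [hI] with x hx
    obtain ⟨y, hy, rfl⟩ := h.surjOn_psi hx
    rw [h.psiInv_psi hy]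
    exact hy.2
  refine ⟨tendsto_order.2 ⟨fun b hb => ?_, fun b hb => hlt.mono fun x hx => hx.trans hb⟩, hlt⟩
  have hb' : max b (tc / 2) ∈ Set.Ioo 0 tc :=
    ⟨lt_max_of_lt_right (half_pos h.1), max_lt hb (half_lt_self h.1)⟩
  filter_upwards [hI, Ioo_mem_nhdsLT (h.psi_mem hμ hb').2] with x hx hxb
  obtain ⟨y, hy, rfl⟩ := h.surjOn_psi hx
  rw [h.psiInv_psi hy]
  exact (le_max_left _ _).trans_lt ((h.strictMonoOn_psi.lt_iff_lt
    (Set.Ioo_subset_Icc_self hb') (Set.Ioo_subset_Icc_self hy)).1 hxb.1)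

theorem Star.comp_psi_eventuallyEq (h : Star μ tc) {y : ℝ} (hy : y ∈ Set.Ioo 0 tc) :
    (fun x => Phi μ (psiInv μ tc x)) ∘ psi μ =ᶠ[𝓝 y] Phi μ := by
  filter_upwards [Ioo_mem_nhds hy.1 hy.2] with z hz
  rw [Function.comp_apply, h.psiInv_psi hz]

/-- Composition with ψ gives back `Phi`, and ψ is a local analytic isomorphism because its
derivative is nonzero. -/
theorem Star.analyticAt_Phi_psiInv (h : Star μ tc) (hμ : μ 0 + μ 1 < 1) {x : ℝ}
    (hx : x ∈ Set.Ioo 0 (psi μ tc)) : AnalyticAt ℝ (fun x => Phi μ (psiInv μ tc x)) x := by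
  obtain ⟨y, hy, rfl⟩ := h.surjOn_psi hx
  refine (analyticAt_comp_iff_of_deriv_ne_zero (h.analyticAt_psi hy.1.le hy.2) ?_).1
    ((h.analyticAt_Phi hμ hy.1.le hy.2).congr (h.comp_psi_eventuallyEq hy).symm)
  rw [(h.hasDerivAt_psi hy.1 hy.2).deriv]
  exact (h.psiDeriv_pos hy.1.le hy.2).ne'

theorem Star.deriv_Phi_psiInv (h : Star μ tc) (hμ : μ 0 + μ 1 < 1) {y : ℝ}
    (hy : y ∈ Set.Ioo 0 tc) :
    deriv (fun x => Phi μ (psiInv μ tc x)) (psi μ y) = PhiSlope μ y := by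
  have h1 := (h.analyticAt_Phi_psiInv hμ (h.psi_mem hμ hy)).differentiableAt.hasDerivAt.comp y
    (h.hasDerivAt_psi hy.1 hy.2)
  exact mul_right_cancel₀ (h.psiDeriv_pos hy.1.le hy.2).ne'
    (h1.unique ((h.hasDerivAt_Phi hμ hy.1 hy.2).congr_of_eventuallyEq
      (h.comp_psi_eventuallyEq hy)))

theorem Star.deriv_deriv_Phi_psiInv (h : Star μ tc) (hμ : μ 0 + μ 1 < 1) {y : ℝ}
    (hy : y ∈ Set.Ioo 0 tc) :
    deriv (deriv fun x => Phi μ (psiInv μ tc x)) (psi μ y) =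
      PhiSlopeDeriv μ y * (psiDeriv μ y)⁻¹ := by
  have h1 := (h.analyticAt_Phi_psiInv hμ (h.psi_mem hμ hy)).deriv.differentiableAt.hasDerivAt.comp
    y (h.hasDerivAt_psi hy.1 hy.2)
  have hE : deriv (fun x => Phi μ (psiInv μ tc x)) ∘ psi μ =ᶠ[𝓝 y] PhiSlope μ := by
    filter_upwards [Ioo_mem_nhds hy.1 hy.2] with z hz using h.deriv_Phi_psiInv hμ hz
  rw [eq_mul_inv_iff_mul_eq₀ (h.psiDeriv_pos hy.1.le hy.2).ne']
  exact h1.unique ((h.hasDerivAt_PhiSlope hμ hy.1 hy.2).congr_of_eventuallyEq hE)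

/-! ### The radius of convergence -/

/-- The identity theorem extends the equality known for small `x`. A general `ρ` is allowed because
the statement serves twice: for a hypothetical radius below `psi μ tc`, then for `psi μ tc` itself.
-/
theorem Star.psSum_eq_of_le (h : Star μ tc) (hμ : μ 0 + μ 1 < 1) {ρ : ℝ} (hρ : 0 < ρ)
    (hρc : ρ ≤ psi μ tc) (hc : ∀ s, 0 ≤ s → s < ρ → PSConv (F₀ μ) s) {x : ℝ} (hx : 0 < x)
    (hxρ : x < ρ) : psSum (F₀ μ) x = Phi μ (psiInv μ tc x) := by
  have hG := h.G_pos h.1.le le_rfl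
  have htc := h.1
  have hx0 : 0 < tc / (4 * G μ tc) := by positivity
  have hf : AnalyticOnNhd ℝ (psSum (F₀ μ)) (Set.Ioo 0 ρ) := fun y hy => by
    obtain ⟨s, hys, hsρ⟩ := exists_between hy.2
    exact (hc s (hy.1.trans hys).le hsρ).analyticAt hy.1.le hys
  have hg : AnalyticOnNhd ℝ (fun x => Phi μ (psiInv μ tc x)) (Set.Ioo 0 ρ) := fun y hy =>
    h.analyticAt_Phi_psiInv hμ ⟨hy.1, hy.2.trans_le hρc⟩
  obtain ⟨z, hz0, hz⟩ := exists_between (lt_min hx0 hρ)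
  refine hf.eqOn_of_preconnected_of_eventuallyEq hg isPreconnected_Ioo
    (z₀ := z) ⟨hz0, hz.trans_le (min_le_right _ _)⟩ ?_ ⟨hx, hxρ⟩
  filter_upwards [Ioo_mem_nhds hz0 (hz.trans_le (min_le_left _ _))] with w hw
  have hw4 : 4 * w * G μ tc < tc := by
    have := (lt_div_iff₀ (by positivity)).1 hw.2
    linarith
  obtain ⟨-, y, hy, rfl, hwy⟩ := h.exists_psi_eq hμ hw.1 hw4
  rw [hwy, h.psiInv_psi hy]

theorem Star.le_psRadius_F₀ (h : Star μ tc) (hμ : μ 0 + μ 1 < 1) :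
    ENNReal.ofReal (psi μ tc) ≤ psRadius (F₀ μ) := by
  by_contra! hlt
  have hG := h.G_pos h.1.le le_rfl
  have htc := h.1
  have hpos : 0 < psRadius (F₀ μ) := by
    -- At this point `4 * x * G μ tc = tc / 2`, within the range of the quadratic method.
    have hx0 : 0 < tc / (8 * G μ tc) := by positivity
    refine lt_of_lt_of_le (ENNReal.ofReal_pos.2 hx0)
      (le_psRadius hx0.le (h.exists_psi_eq hμ hx0 ?_).1)
    field_simp
    norm_num
  have hfin : psRadius (F₀ μ) ≠ ⊤ := hlt.ne_top
  obtain ⟨ρ, hρ0, hρ⟩ : ∃ ρ : ℝ, 0 ≤ ρ ∧ psRadius (F₀ μ) = ENNReal.ofReal ρ :=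
    ⟨_, ENNReal.toReal_nonneg, (ENNReal.ofReal_toReal hfin).symm⟩
  rw [hρ, ENNReal.ofReal_pos] at hpos
  rw [hρ, ENNReal.ofReal_lt_ofReal_iff (h.psi_pos hμ h.1 le_rfl)] at hlt
  have hc : ∀ s, 0 ≤ s → s < ρ → PSConv (F₀ μ) s := fun s hs hsρ =>
    psConv_of_lt_psRadius hs (by rwa [hρ, ENNReal.ofReal_lt_ofReal_iff hpos])
  obtain ⟨t, hρt, ht⟩ := exists_psConv_of_analyticAt (F₀_coeff_nonneg μ) hpos hc
    (h.analyticAt_Phi_psiInv hμ ⟨hpos, hlt⟩)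
    fun s hs hsρ => h.psSum_eq_of_le hμ hpos hlt.le hc hs hsρ
  have := le_psRadius (hpos.trans hρt).le ht
  rw [hρ, ENNReal.ofReal_le_ofReal_iff hpos.le] at this
  exact hρt.not_ge this

theorem Star.psConv_F₀ (h : Star μ tc) (hμ : μ 0 + μ 1 < 1) {s : ℝ} (hs : 0 ≤ s)
    (hsc : s < psi μ tc) : PSConv (F₀ μ) s :=
  psConv_of_lt_psRadius hs (((ENNReal.ofReal_lt_ofReal_iff (hs.trans_lt hsc)).2 hsc).trans_le
    (h.le_psRadius_F₀ hμ))

theorem Star.psSum_F₀_eq (h : Star μ tc) (hμ : μ 0 + μ 1 < 1) {x : ℝ}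
    (hx : x ∈ Set.Ioo 0 (psi μ tc)) : psSum (F₀ μ) x = Phi μ (psiInv μ tc x) :=
  h.psSum_eq_of_le hμ (h.psi_pos hμ h.1 le_rfl) le_rfl (fun _ hs hsc => h.psConv_F₀ hμ hs hsc)
    hx.1 hx.2

/-- By the chain rule the second derivative at `psi μ y` is `PhiSlopeDeriv μ y / psiDeriv μ y`, with
a positive limit above and `0+` below. -/
theorem Star.tendsto_iteratedDeriv (h : Star μ tc) (hμ : μ 0 + μ 1 < 1) :
    Tendsto (iteratedDeriv 2 (psSum (F₀ μ))) (𝓝[<] (psi μ tc)) atTop := by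
  obtain ⟨c, hc, hlim⟩ := h.tendsto_PhiSlopeDeriv hμ
  have h1 : Tendsto (fun y => PhiSlopeDeriv μ y * (psiDeriv μ y)⁻¹) (𝓝[<] tc) atTop :=
    hlim.pos_mul_atTop hc (tendsto_inv_nhdsGT_zero.comp h.tendsto_psiDeriv)
  refine (h1.comp (h.tendsto_psiInv hμ)).congr' ?_
  filter_upwards [Ioo_mem_nhdsLT (h.psi_pos hμ h.1 le_rfl)] with x hx
  have hE : psSum (F₀ μ) =ᶠ[𝓝 x] fun x => Phi μ (psiInv μ tc x) := by
    filter_upwards [Ioo_mem_nhds hx.1 hx.2] with z hz using h.psSum_F₀_eq hμ hz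
  rw [hE.iteratedDeriv_eq 2, iteratedDeriv_succ, iteratedDeriv_one]
  obtain ⟨y, hy, rfl⟩ := h.surjOn_psi hx
  rw [h.deriv_deriv_Phi_psiInv hμ hy, Function.comp_apply, h.psiInv_psi hy]

theorem Star.psRadius_F₀ (h : Star μ tc) (hμ : μ 0 + μ 1 < 1) :
    psRadius (F₀ μ) = ENNReal.ofReal (psi μ tc) := by
  refine le_antisymm (not_lt.1 fun hlt => ?_) (h.le_psRadius_F₀ hμ)
  -- A larger radius would make the second derivative continuous at `psi μ tc`, against its blow-up.
  have ha := analyticAt_psSum_of_lt_psRadius (h.psi_pos hμ h.1 le_rfl).le hlt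
  have h1 : Tendsto (iteratedDeriv 2 (psSum (F₀ μ))) (𝓝[<] (psi μ tc))
      (𝓝 (iteratedDeriv 2 (psSum (F₀ μ)) (psi μ tc))) := by
    rw [iteratedDeriv_succ, iteratedDeriv_one]
    exact ha.deriv.deriv.continuousAt.tendsto.mono_left nhdsWithin_le_nhds
  exact not_tendsto_nhds_of_tendsto_atTop (h.tendsto_iteratedDeriv hμ) _ h1

theorem Star.hasSum_F₀ (h : Star μ tc) (hμ : μ 0 + μ 1 < 1) :
    HasSum (fun n => PowerSeries.coeff n (F₀ μ) * psi μ tc ^ n) (Phi μ tc) := by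
  have hxc := h.psi_pos hμ h.1 le_rfl
  refine hasSum_of_tendsto_psSum (F₀_coeff_nonneg μ) hxc (fun s hs hsc => h.psConv_F₀ hμ hs hsc) ?_
  have h1 : Tendsto (Phi μ) (𝓝[<] tc) (𝓝 (Phi μ tc)) :=
    (h.continuousOn_Phi hμ tc ⟨h.1.le, le_rfl⟩).tendsto.mono_left (nhdsWithin_le_of_mem
      (mem_of_superset (Ioo_mem_nhdsLT h.1) Set.Ioo_subset_Icc_self))
  refine (h1.comp (h.tendsto_psiInv hμ)).congr' ?_
  filter_upwards [Ioo_mem_nhdsLT hxc] with x hx using (h.psSum_F₀_eq hμ hx).symm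

end Star

end Parking

theorem mainTheorem8 (μ : PMF ℕ) (hμ : μ 0 + μ 1 < 1) (tc : ℝ) (hstar : Parking.Star μ tc) :
    0 < Parking.psi μ tc ∧
    Tendsto (iteratedDeriv 2 (Parking.psSum (Parking.F₀ μ))) (𝓝[<] (Parking.psi μ tc)) atTop ∧
    Parking.psRadius (Parking.F₀ μ) = ENNReal.ofReal (Parking.psi μ tc) ∧
    HasSum (fun n : ℕ => PowerSeries.coeff n (Parking.F₀ μ) * Parking.psi μ tc ^ n)
      (2 * Parking.G μ tc * √(Parking.G μ tc - tc * Parking.G' μ tc) /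
        ((2 * Parking.G μ tc - tc * Parking.G' μ tc) * √(Parking.G μ 0))) :=
  ⟨hstar.psi_pos hμ hstar.1 le_rfl, hstar.tendsto_iteratedDeriv hμ, hstar.psRadius_F₀ hμ,
    hstar.hasSum_F₀ hμ⟩
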